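/- **Setting.** For a probability distribution $D$ on $[N]=\{0,\dots,N-1\}$ and $S\subseteq[N]$ write $D(S)=\sum_{i\in S}D(i)$; if $D(S)>0$ let $D_S$ be the conditional distribution, $D_S(i)=D(i)/D(S)$ for $i\in S$ and $D_S(i)=0$ otherwise. Let $T\ge 1$ be an integer. A $\mathsf{PQCOND}_D$ oracle with parameter $T$ is given by a map $O$ which assigns to each query set $S\subseteq[N]$ with $|S|=2$ or $|S|=N$ and each $t\in[T]$ an element $O(S,t)\in[N]$, such that $D_S(i)=|\{t\in[T]:O(S,t)=i\}|/T$ for every such $S$ with $D(S)>0$ and every $i\in[N]$. One query applies the unitary $$U\,|S\rangle|t\rangle|\beta\rangle=|S\rangle|t\rangle|\beta+O(S,t)\bmod N\rangle .$$ A quantum algorithm making $q$ queries acts on these three registers and a finite-dimensional workspace. It starts in a fixed basis state, applies oracle-independent unitaries interleaved with $q$ applications of $U$, measures in the computational basis, and outputs one bit computed from the measurement result. For $f:\{0,1\}^n\to\{0,1\}^m$ with $n\ge m$ let $F_i=|\{x\in\{0,1\}^n:f(x)=i\}|/2^n$ for $i\in\{0,1\}^m$. Identify $\{0,1\}^m$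 with $[2^m]$ by binary expansion. $\mathsf{PQCOND}$ access to $f$ means access to a $\mathsf{PQCOND}_D$ oracle for the distribution $D(i)=F_i$ on $[N]$, $N=2^m$. **Theorem.** Balancedness can be tested with $\tilde O(1/\epsilon)$ $\mathsf{PQCOND}$ queries. Precisely, there are absolute constants $C>0$ and $k\in\mathbb N$ such that for all $m\in\mathbb N$, $\epsilon>0$ and $T\ge1$ there is a quantum algorithm that makes at most $$C\cdot\frac1\epsilon\cdot\log^k\!\Big(2+\frac1\epsilon\Big)$$ queries and has the following property for every $n\ge m$, every $f:\{0,1\}^n\to\{0,1\}^m$ and every $\mathsf{PQCOND}$ oracle for $f$ with parameter $T$: - if $f$ is balanced, i.e. $F_i=2^{-m}$ for all $i\in\{0,1\}^m$, the algorithm outputs "balanced" with probability at least $2/3$; - if $f$ is $\epsilon$-far from balanced, i.e. $\sum_{i\in\{0,1\}^m}|F_i-2^{-m}|\ge\epsilon$, the algorithm outputs "far" with probability at least $2/3$. -/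

import Mathlib

namespace BalancedTest

/-- The weight `D(S)` of a set `S ⊆ [N]`. -/
noncomputable def weight {N : ℕ} (D : Fin N → ℝ) (S : Finset (Fin N)) : ℝ :=
  ∑ i ∈ S, D i

/-- The conditional distribution `D_S` (meaningful when `D(S) > 0`). -/
noncomputable def condDist {N : ℕ} (D : Fin N → ℝ) (S : Finset (Fin N)) (i : Fin N) : ℝ :=
  if i ∈ S then D i / weight D S else 0

/-- The query sets that a pairwise conditional oracle accepts: `|S| = 2` or `|S| = N`. -/
abbrev QuerySet (N : ℕ) : Type := {S : Finset (Fin N) // S.card = 2 ∨ S.card = N}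

/-- The classical map `O(S, t)` behind a pairwise conditional oracle. -/
abbrev OracleMap (N T : ℕ) : Type := QuerySet N → Fin T → Fin N

/-- `O` represents the distribution `D` over `[N]`: for every admissible query set `S` with
`D(S) > 0` and every `i`, `D_S(i) = |{t ∈ [T] : O(S, t) = i}| / T`. Nothing is required of
`O(S, ·)` when `D(S) = 0`. -/
def Represents {N T : ℕ} (O : OracleMap N T) (D : Fin N → ℝ) : Prop :=
  ∀ S : QuerySet N, 0 < weight D S.1 → ∀ i : Fin N,
    condDist D S.1 i = ((Finset.univ.filter fun t : Fin T => O S t = i).card : ℝ) / (T : ℝ)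

/-- Labels `(S, t, β, w)` of the computational basis: query set, element of `[T]`, output
register, and the private workspace of the algorithm. -/
abbrev BasisLabel (N T : ℕ) (W : Type) : Type := QuerySet N × Fin T × Fin N × W

/-- The action of a query on basis labels,
`|S⟩|t⟩|β⟩|w⟩ ↦ |S⟩|t⟩|β + O(S, t) mod N⟩|w⟩`. -/
def queryLabel {N T : ℕ} {W : Type} (O : OracleMap N T) (b : BasisLabel N T W) :
    BasisLabel N T W :=
  (b.1, b.2.1, b.2.2.1 + O b.1 b.2.1, b.2.2.2)

/-- The matrix of one `PQCOND` query, tensored with the identity on the workspace. -/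
def queryMatrix {N T : ℕ} {W : Type} [DecidableEq W] (O : OracleMap N T) :
    Matrix (BasisLabel N T W) (BasisLabel N T W) ℂ :=
  Matrix.of fun b' b => if b' = queryLabel O b then 1 else 0

/-- A quantum query algorithm with `PQCOND` access to an (unknown) distribution over `[N]`, where
the oracle has a `T`-dimensional sample register. It starts in a basis state, applies
`gate 0`, then alternates oracle queries with the gates `gate 1, …, gate queries`, and finally
measures in the computational basis and outputs the bit `outcome b` when it sees `b`. The gates are
arbitrary unitaries on all registers that do not depend on the oracle; the gates after
`gate queries` are not used. -/
structure QueryAlgorithm (N T : ℕ) where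
  Work : Type
  [workFintype : Fintype Work]
  [workDecEq : DecidableEq Work]
  queries : ℕ
  init : BasisLabel N T Work
  gate : ℕ → Matrix.unitaryGroup (BasisLabel N T Work) ℂ
  outcome : BasisLabel N T Work → Bool

attribute [instance] QueryAlgorithm.workFintype QueryAlgorithm.workDecEq

/-- The state vector after `j` queries (and the gate that follows the last of them). -/
noncomputable def QueryAlgorithm.state {N T : ℕ} (A : QueryAlgorithm N T) (O : OracleMap N T) :
    ℕ → (BasisLabel N T A.Work → ℂ)
  | 0 => (A.gate 0).1.mulVec (Pi.single A.init 1)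
  | j + 1 => (A.gate (j + 1)).1.mulVec ((queryMatrix O).mulVec (A.state O j))

/-- The probability (Born rule) that the algorithm, run with oracle `O`, outputs the bit `c`. -/
noncomputable def QueryAlgorithm.outputProb {N T : ℕ} (A : QueryAlgorithm N T)
    (O : OracleMap N T) (c : Bool) : ℝ :=
  ∑ b ∈ Finset.univ.filter (fun b => A.outcome b = c), ‖A.state O A.queries b‖ ^ 2

/-- `F_y = |{x ∈ {0,1}^n : f(x) = y}| / 2^n`. -/
noncomputable def outputFreq {n m : ℕ} (f : (Fin n → Fin 2) → (Fin m → Fin 2))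
    (y : Fin m → Fin 2) : ℝ :=
  ((Finset.univ.filter fun x => f x = y).card : ℝ) / 2 ^ n

/-- `f` is balanced. -/
def IsBalanced {n m : ℕ} (f : (Fin n → Fin 2) → (Fin m → Fin 2)) : Prop :=
  ∀ y, outputFreq f y = 1 / 2 ^ m

/-- `f` is `ε`-far from balanced. -/
def IsFarFromBalanced {n m : ℕ} (ε : ℝ) (f : (Fin n → Fin 2) → (Fin m → Fin 2)) : Prop :=
  ε ≤ ∑ y, |outputFreq f y - 1 / 2 ^ m|

/-- The output distribution of `f` as a distribution over `[2^m]`; bit strings are read as numbers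
in binary. -/
noncomputable def outputDist {n m : ℕ} (f : (Fin n → Fin 2) → (Fin m → Fin 2)) :
    Fin (2 ^ m) → ℝ :=
  fun i => outputFreq f (finFunctionFinEquiv.symm i)

end BalancedTest

/-! Sample `x` from `D`, draw `y` uniformly and query `{x, y}`: the answer has bias `(D x - D y) /
(D x + D y)`. Run this coherently, with the sample index of the pair query in uniform superposition.
The component in which that index is uniform again and the output is `(|x⟩ - |y⟩) / √2` has an
amplitude proportional to the bias, so its total squared length `s` is half the mean squared bias.
For uniform `D` it vanishes; for `D` at distance at least `ε` it is at least `ε ^ 2 / 8`, by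
Cauchy–Schwarz (`sq_le_sum_mul_bias_sq`).

Distinguishing these cases takes `O(1 / ε)` Grover steps `Q` about the start state `v`
(`exists_detection_algorithm`): apply `Q ^ k` for `k < M` in uniform superposition and test for
return to the start. If `s = 0`, then `Q` fixes `v` and the return is certain. Otherwise `v = (1 -
Q) φ` with `‖φ‖ ^ 2 = 1 / (4 * s)`, the sum of the `Q ^ k v` telescopes, and the return probability
is at most `1 / (M ^ 2 * s)` (`norm_sum_groverStep_sq_le`). No logarithmic factor arises. -/

namespace BalancedTest

open Matrix

/-! ### Unitaries, reflections and averages of Grover iterates. -/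

section LinearAlgebra

variable {L : Type*}

section

variable [DecidableEq L]

/-- The permutation matrix `|l⟩ ↦ |σ l⟩`. -/
def permMat (σ : L ≃ L) : Matrix L L ℂ := Matrix.of fun b' b => if b' = σ b then 1 else 0

theorem permMat_refl : permMat (Equiv.refl L) = 1 := by
  ext i j
  simp [permMat, Matrix.one_apply]
  rfl

theorem permMat_conjTranspose (σ : L ≃ L) : (permMat σ)ᴴ = permMat σ.symm := by
  ext i j
  simp only [permMat, conjTranspose_apply, of_apply, Equiv.eq_symm_apply]
  split_ifs with h1 h2 h2
  · simp
  · exact absurd h1.symm h2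
  · exact absurd h2.symm h1
  · simp

end

variable [Fintype L]

theorem dotProduct_star_self_eq_sum (v : L → ℂ) :
    star v ⬝ᵥ v = ((∑ i, ‖v i‖ ^ 2 : ℝ) : ℂ) := by
  simp only [dotProduct, Pi.star_apply, Complex.ofReal_sum]
  refine Finset.sum_congr rfl fun i _ => ?_
  rw [Complex.star_def, Complex.conj_mul']
  push_cast
  rfl

theorem norm_star_dotProduct_sq_le (v w : L → ℂ) :
    ‖star v ⬝ᵥ w‖ ^ 2 ≤ (∑ i, ‖v i‖ ^ 2) * ∑ i, ‖w i‖ ^ 2 := by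
  have h := norm_inner_le_norm (𝕜 := ℂ) (WithLp.toLp 2 v) (WithLp.toLp 2 w)
  rw [EuclideanSpace.inner_eq_star_dotProduct, dotProduct_comm] at h
  have h2 := pow_le_pow_left₀ (norm_nonneg _) h 2
  rwa [mul_pow, EuclideanSpace.norm_sq_eq, EuclideanSpace.norm_sq_eq] at h2

/-- The projection onto the line spanned by a unit vector `v`. -/
def lineProj (v : L → ℂ) : Matrix L L ℂ := vecMulVec v (star v)

theorem lineProj_mulVec (v w : L → ℂ) : lineProj v *ᵥ w = (star v ⬝ᵥ w) • v := by
  ext i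
  simp [lineProj, vecMulVec_mulVec, mul_comm]

variable [DecidableEq L]

/-- Every unit vector is the image of a given basis vector under some unitary matrix. -/
theorem exists_unitary_mulVec_single (i : L) (v : L → ℂ) (hv : star v ⬝ᵥ v = 1) :
    ∃ G ∈ unitaryGroup L ℂ, G *ᵥ Pi.single i 1 = v := by
  have hn : ‖WithLp.toLp 2 v‖ = 1 := by
    have h : inner ℂ (WithLp.toLp 2 v) (WithLp.toLp 2 v) = (1 : ℂ) := by
      rw [EuclideanSpace.inner_eq_star_dotProduct, dotProduct_comm]
      exact hv
    have h' := inner_self_eq_norm_sq_to_K (𝕜 := ℂ) (WithLp.toLp 2 v)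
    rw [h] at h'
    have h2 : ‖WithLp.toLp 2 v‖ ^ 2 = 1 := by
      exact_mod_cast (show ((‖WithLp.toLp 2 v‖ : ℝ) : ℂ) ^ 2 = 1 from h'.symm)
    exact (pow_eq_one_iff_of_nonneg (norm_nonneg _) two_ne_zero).1 h2
  have ho : Orthonormal ℂ (({i} : Set L).domRestrict fun _ => WithLp.toLp 2 v) := by
    refine ⟨fun _ => hn, ?_⟩
    rintro ⟨a, ha⟩ ⟨b, hb⟩ hab
    exact absurd (Subtype.ext (ha.trans hb.symm)) hab
  obtain ⟨b, hb⟩ := ho.exists_orthonormalBasis_extension_of_card_eq (by simp)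
  refine ⟨_, OrthonormalBasis.toMatrix_orthonormalBasis_mem_unitary
    (EuclideanSpace.basisFun L ℂ) b, ?_⟩
  ext j
  rw [mulVec_single_one, Matrix.col_apply, Module.Basis.toMatrix_apply, hb i rfl]
  simp

theorem star_mulVec_dotProduct_mulVec (A : Matrix L L ℂ) (hA : A ∈ unitaryGroup L ℂ)
    (v w : L → ℂ) : star (A *ᵥ v) ⬝ᵥ (A *ᵥ w) = star v ⬝ᵥ w := by
  rw [star_mulVec, ← dotProduct_mulVec, mulVec_mulVec, ← star_eq_conjTranspose,
    mem_unitaryGroup_iff'.1 hA, one_mulVec]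

theorem sum_norm_sq_mulVec (A : Matrix L L ℂ) (hA : A ∈ unitaryGroup L ℂ) (v : L → ℂ) :
    ∑ i, ‖(A *ᵥ v) i‖ ^ 2 = ∑ i, ‖v i‖ ^ 2 := by
  have h := star_mulVec_dotProduct_mulVec A hA v v
  rw [dotProduct_star_self_eq_sum, dotProduct_star_self_eq_sum] at h
  exact_mod_cast h

theorem one_sub_two_smul_mem_unitaryGroup (P : Matrix L L ℂ) (hP : Pᴴ = P) (hPP : P * P = P) :
    1 - (2 : ℂ) • P ∈ unitaryGroup L ℂ := by
  rw [mem_unitaryGroup_iff, star_eq_conjTranspose, conjTranspose_sub, conjTranspose_smul, hP]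
  simp only [conjTranspose_one, mul_sub, sub_mul, mul_one, one_mul, smul_mul_assoc,
    mul_smul_comm, hPP, star_ofNat]
  module

theorem two_smul_lineProj_sub_one_mem_unitaryGroup (v : L → ℂ) (hv : star v ⬝ᵥ v = 1) :
    (2 : ℂ) • lineProj v - 1 ∈ unitaryGroup L ℂ := by
  have h := one_sub_two_smul_mem_unitaryGroup (lineProj v)
    (by rw [lineProj, conjTranspose_vecMulVec, star_star])
    (by rw [lineProj, vecMulVec_mul_vecMulVec, hv, one_smul])
  rw [mem_unitaryGroup_iff] at h ⊢
  rwa [← neg_sub, star_neg, neg_mul_neg]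

/-- One Grover iteration: a reflection through `1 - P` followed by a reflection about `v`. -/
def groverStep (v : L → ℂ) (P : Matrix L L ℂ) : Matrix L L ℂ :=
  ((2 : ℂ) • lineProj v - 1) * (1 - (2 : ℂ) • P)

theorem groverStep_mem_unitaryGroup (v : L → ℂ) (hv : star v ⬝ᵥ v = 1) (P : Matrix L L ℂ)
    (hP : Pᴴ = P) (hPP : P * P = P) : groverStep v P ∈ unitaryGroup L ℂ :=
  mul_mem (two_smul_lineProj_sub_one_mem_unitaryGroup v hv)
    (one_sub_two_smul_mem_unitaryGroup P hP hPP)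

theorem groverStep_mulVec_of_mulVec_eq_zero (v : L → ℂ) (hv : star v ⬝ᵥ v = 1)
    (P : Matrix L L ℂ) (h : P *ᵥ v = 0) : groverStep v P *ᵥ v = v := by
  have h1 : (1 - (2 : ℂ) • P) *ᵥ v = v := by
    rw [sub_mulVec, smul_mulVec, h, smul_zero, one_mulVec, sub_zero]
  rw [groverStep, ← mulVec_mulVec, h1, sub_mulVec, smul_mulVec, lineProj_mulVec, hv, one_mulVec]
  module

/-- The first reflection negates `P v`, and reflecting `-P v` about `v` returns `P v` up to a
multiple of `v`. Hence `v` is in the range of `1 - groverStep v P` once `⟨v, P v⟩ ≠ 0`. -/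
theorem one_sub_groverStep_mulVec (v : L → ℂ) (P : Matrix L L ℂ) (hPP : P * P = P) :
    (1 - groverStep v P) *ᵥ (P *ᵥ v) = (2 * (star v ⬝ᵥ (P *ᵥ v))) • v := by
  have h1 : (1 - (2 : ℂ) • P) *ᵥ (P *ᵥ v) = -(P *ᵥ v) := by
    rw [sub_mulVec, smul_mulVec, one_mulVec, mulVec_mulVec, hPP]
    module
  rw [sub_mulVec, one_mulVec, groverStep, ← mulVec_mulVec, h1, sub_mulVec, smul_mulVec,
    lineProj_mulVec, dotProduct_neg, one_mulVec]
  module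

/-- If `P v` has squared length `s`, the iterates of the Grover step average out along `v`. -/
theorem norm_sum_groverStep_sq_le (v : L → ℂ) (hv : star v ⬝ᵥ v = 1) (P : Matrix L L ℂ)
    (hP : Pᴴ = P) (hPP : P * P = P) (s : ℝ) (hs : 0 < s)
    (hvP : star v ⬝ᵥ (P *ᵥ v) = (s : ℂ)) (M : ℕ) :
    ‖∑ k ∈ Finset.range M, star v ⬝ᵥ (groverStep v P ^ k *ᵥ v)‖ ^ 2 ≤ 1 / s := by
  set Q := groverStep v P with hQ
  have hs' : (s : ℂ) ≠ 0 := by exact_mod_cast hs.ne'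
  -- A preimage of `v` under `1 - Q`; it turns the geometric sum into `φ - Q ^ M φ`.
  set φ : L → ℂ := (2 * (s : ℂ))⁻¹ • (P *ᵥ v) with hφ
  have h1 : (1 - Q) *ᵥ φ = v := by
    rw [hφ, mulVec_smul, one_sub_groverStep_mulVec v P hPP, hvP, smul_smul,
      inv_mul_cancel₀ (by simpa using hs'), one_smul]
  have h2 : ∑ k ∈ Finset.range M, star v ⬝ᵥ (Q ^ k *ᵥ v)
      = star v ⬝ᵥ φ - star v ⬝ᵥ (Q ^ M *ᵥ φ) := by
    rw [← dotProduct_sum, ← sum_mulVec]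
    nth_rw 2 [← h1]
    rw [mulVec_mulVec, geom_sum_mul_neg, sub_mulVec, one_mulVec, dotProduct_sub]
  have hφn : ∑ i, ‖φ i‖ ^ 2 = 1 / (4 * s) := by
    have h3 : star φ ⬝ᵥ φ = ((1 / (4 * s) : ℝ) : ℂ) := by
      rw [hφ, star_smul, smul_dotProduct, dotProduct_smul, star_mulVec, hP, ← dotProduct_mulVec,
        mulVec_mulVec, hPP, hvP]
      simp only [star_inv₀, star_mul', star_ofNat, Complex.star_def, Complex.conj_ofReal,
        smul_eq_mul]
      push_cast
      field_simp
      norm_num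
    rw [dotProduct_star_self_eq_sum] at h3
    exact_mod_cast h3
  have hvn : ∑ i, ‖v i‖ ^ 2 = 1 := by
    rw [dotProduct_star_self_eq_sum] at hv
    exact_mod_cast hv
  have hQM : Q ^ M ∈ unitaryGroup L ℂ := pow_mem (groverStep_mem_unitaryGroup v hv P hP hPP) M
  have e1 := norm_star_dotProduct_sq_le v φ
  have e2 := norm_star_dotProduct_sq_le v (Q ^ M *ᵥ φ)
  rw [sum_norm_sq_mulVec _ hQM] at e2
  rw [hvn, hφn, one_mul] at e1 e2
  rw [h2]
  have e3 := norm_sub_le (star v ⬝ᵥ φ) (star v ⬝ᵥ (Q ^ M *ᵥ φ))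
  have e4 := pow_le_pow_left₀ (norm_nonneg _) e3 2
  have e5 : 1 / s = 4 * (1 / (4 * s)) := by field_simp
  -- Uses `(a + b) ^ 2 ≤ 2 * a ^ 2 + 2 * b ^ 2`, both squares being at most `1 / (4 * s)`.
  nlinarith [sq_nonneg (‖star v ⬝ᵥ φ‖ - ‖star v ⬝ᵥ (Q ^ M *ᵥ φ)‖)]

theorem permMat_mul (σ τ : L ≃ L) : permMat σ * permMat τ = permMat (τ.trans σ) := by
  ext i j
  simp [permMat, Matrix.mul_apply]
  rfl

theorem permMat_mem_unitaryGroup (σ : L ≃ L) : permMat σ ∈ unitaryGroup L ℂ := by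
  rw [mem_unitaryGroup_iff, star_eq_conjTranspose, permMat_conjTranspose, permMat_mul,
    Equiv.symm_trans_self, permMat_refl]

end LinearAlgebra

/-! ### Query counting for oracle-dependent unitaries. -/

section Circuits

variable {N T : ℕ} {W : Type} [DecidableEq W]

/-- The permutation of the basis labels made by one query. -/
def queryEquiv [NeZero N] (O : OracleMap N T) : BasisLabel N T W ≃ BasisLabel N T W where
  toFun := queryLabel O
  invFun b := (b.1, b.2.1, b.2.2.1 - O b.1 b.2.1, b.2.2.2)
  left_inv b := by simp [queryLabel]
  right_inv b := by simp [queryLabel]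

/-- Negation of the output register. -/
def negEquiv [NeZero N] : BasisLabel N T W ≃ BasisLabel N T W where
  toFun b := (b.1, b.2.1, -b.2.2.1, b.2.2.2)
  invFun b := (b.1, b.2.1, -b.2.2.1, b.2.2.2)
  left_inv b := by simp
  right_inv b := by simp

theorem queryMatrix_eq_permMat [NeZero N] (O : OracleMap N T) :
    queryMatrix (W := W) O = permMat (queryEquiv O) := rfl

variable [Fintype W]

theorem queryMatrix_mem_unitaryGroup [NeZero N] (O : OracleMap N T) :
    queryMatrix (W := W) O ∈ unitaryGroup _ ℂ := by
  rw [queryMatrix_eq_permMat]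
  exact permMat_mem_unitaryGroup _

/-- The inverse query subtracts `O(S, t)`; negating the output register before and after turns this
into addition, so inverting a circuit costs no extra queries. -/
theorem queryMatrix_conjTranspose [NeZero N] (O : OracleMap N T) :
    (queryMatrix (W := W) O)ᴴ = permMat negEquiv * queryMatrix O * permMat negEquiv := by
  rw [queryMatrix_eq_permMat, permMat_conjTranspose, permMat_mul, permMat_mul]
  congr 1
  ext b : 1
  simp [queryEquiv, negEquiv, queryLabel, sub_eq_add_neg, add_comm]

/-- `Circuit q F` says that the oracle-dependent matrix `F O` is a product of oracle-independent
unitaries and `q` queries to `O`. -/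
inductive Circuit : ℕ → (OracleMap N T → Matrix (BasisLabel N T W) (BasisLabel N T W) ℂ) → Prop
  | gate (g : Matrix (BasisLabel N T W) (BasisLabel N T W) ℂ) (hg : g ∈ unitaryGroup _ ℂ) :
      Circuit 0 fun _ => g
  | query (g : Matrix (BasisLabel N T W) (BasisLabel N T W) ℂ) (hg : g ∈ unitaryGroup _ ℂ)
      (q : ℕ) (F : OracleMap N T → Matrix (BasisLabel N T W) (BasisLabel N T W) ℂ)
      (hF : Circuit q F) : Circuit (q + 1) fun O => g * (queryMatrix O * F O)

theorem Circuit.congr {q q' : ℕ}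
    {F F' : OracleMap N T → Matrix (BasisLabel N T W) (BasisLabel N T W) ℂ}
    (h : Circuit q F) (hq : q = q') (hF : ∀ O, F O = F' O) : Circuit q' F' := by
  obtain rfl : F = F' := funext hF
  exact hq ▸ h

theorem Circuit.gate_mul {q : ℕ}
    {F : OracleMap N T → Matrix (BasisLabel N T W) (BasisLabel N T W) ℂ} (h : Circuit q F)
    (g : Matrix (BasisLabel N T W) (BasisLabel N T W) ℂ) (hg : g ∈ unitaryGroup _ ℂ) :
    Circuit q fun O => g * F O := by
  cases h with
  | gate g' hg' => exact .gate _ (mul_mem hg hg')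
  | query g' hg' q F hF =>
    exact (Circuit.query _ (mul_mem hg hg') q F hF).congr rfl fun O => by simp only [Matrix.mul_assoc]

theorem Circuit.mul {q q' : ℕ}
    {F F' : OracleMap N T → Matrix (BasisLabel N T W) (BasisLabel N T W) ℂ}
    (h : Circuit q F) (h' : Circuit q' F') : Circuit (q + q') fun O => F O * F' O := by
  induction h with
  | gate g hg => exact (h'.gate_mul g hg).congr (zero_add _).symm fun _ => rfl
  | query g hg q F _ ih =>
    exact (Circuit.query g hg _ _ ih).congr (by omega) fun O => by simp only [Matrix.mul_assoc]

theorem circuit_queryMatrix :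
    Circuit 1 (fun O : OracleMap N T => queryMatrix (W := W) O) :=
  (Circuit.query 1 (one_mem _) 0 _ (.gate 1 (one_mem _))).congr rfl fun O => by simp

theorem Circuit.conjTranspose [NeZero N] {q : ℕ}
    {F : OracleMap N T → Matrix (BasisLabel N T W) (BasisLabel N T W) ℂ} (h : Circuit q F) :
    Circuit q fun O => (F O)ᴴ := by
  induction h with
  | gate g hg => exact .gate _ (Unitary.star_mem hg)
  | query g hg q F _ ih =>
    have hn : permMat (negEquiv (N := N) (T := T) (W := W)) ∈ unitaryGroup _ ℂ :=
      permMat_mem_unitaryGroup _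
    refine (ih.mul (((Circuit.gate _ hn).mul circuit_queryMatrix).mul
      (Circuit.gate _ (mul_mem hn (Unitary.star_mem hg))))).congr (by omega) fun O => ?_
    simp only [conjTranspose_mul, queryMatrix_conjTranspose, Matrix.mul_assoc, star_eq_conjTranspose]

theorem Circuit.mem_unitaryGroup [NeZero N] {q : ℕ}
    {F : OracleMap N T → Matrix (BasisLabel N T W) (BasisLabel N T W) ℂ} (h : Circuit q F)
    (O : OracleMap N T) : F O ∈ unitaryGroup _ ℂ := by
  induction h with
  | gate g hg => exact hg
  | query g hg q F _ ih => exact mul_mem hg (mul_mem (queryMatrix_mem_unitaryGroup O) ih)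

/-- Every circuit is run by some algorithm, started in any basis state and with any output. -/
theorem Circuit.exists_algorithm {q : ℕ}
    {F : OracleMap N T → Matrix (BasisLabel N T W) (BasisLabel N T W) ℂ} (h : Circuit q F)
    (b₀ : BasisLabel N T W) :
    ∃ gate : ℕ → unitaryGroup (BasisLabel N T W) ℂ, ∀ (out : BasisLabel N T W → Bool) O,
      (QueryAlgorithm.mk W q b₀ gate out).state O q = F O *ᵥ Pi.single b₀ 1 := by
  -- The state after `j` queries depends only on the gates up to `j`, so a later gate may be
  -- overwritten.
  have key : ∀ (gate gate' : ℕ → unitaryGroup (BasisLabel N T W) ℂ) (out) (O : OracleMap N T)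
      (q q' j : ℕ), (∀ i ≤ j, gate i = gate' i) →
      (QueryAlgorithm.mk W q b₀ gate out).state O j
        = (QueryAlgorithm.mk W q' b₀ gate' out).state O j := by
    intro gate gate' out O q q' j
    induction j with
    | zero => intro hj; simp only [QueryAlgorithm.state, hj 0 le_rfl]
    | succ j ih =>
      intro hj
      simp only [QueryAlgorithm.state, hj (j + 1) le_rfl, ih fun i hi => hj i (by omega)]
  induction h with
  | gate g hg => exact ⟨fun _ => ⟨g, hg⟩, fun out O => rfl⟩
  | query g hg q F _ ih =>
    obtain ⟨gate, hgate⟩ := ih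
    refine ⟨Function.update gate (q + 1) ⟨g, hg⟩, fun out O => ?_⟩
    have hs := key (Function.update gate (q + 1) ⟨g, hg⟩) gate out O (q + 1) q q fun i hi => by
      rw [Function.update_of_ne (by omega)]
    simp only [QueryAlgorithm.state] at hs ⊢
    rw [hs, hgate out O, Function.update_self, mulVec_mulVec, mulVec_mulVec, Matrix.mul_assoc]

end Circuits

/-! ### Adding a control register. -/

section Control

variable {N T : ℕ} {W K : Type}

/-- Separate the control register `K` from the other registers. -/
def splitEquiv : BasisLabel N T (W × K) ≃ BasisLabel N T W × K where
  toFun b := ((b.1, b.2.1, b.2.2.1, b.2.2.2.1), b.2.2.2.2)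
  invFun p := (p.1.1, p.1.2.1, p.1.2.2.1, p.1.2.2.2, p.2)
  left_inv _ := rfl
  right_inv _ := rfl

variable [DecidableEq K]

/-- Apply the matrix `M k` when the control register holds `k`. -/
def controlled (M : K → Matrix (BasisLabel N T W) (BasisLabel N T W) ℂ) :
    Matrix (BasisLabel N T (W × K)) (BasisLabel N T (W × K)) ℂ :=
  (blockDiagonal M).submatrix splitEquiv splitEquiv

theorem controlled_one [DecidableEq W] :
    controlled (fun _ : K => (1 : Matrix (BasisLabel N T W) (BasisLabel N T W) ℂ)) = 1 := by
  have : (fun _ : K => (1 : Matrix (BasisLabel N T W) (BasisLabel N T W) ℂ)) = 1 := rfl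
  rw [controlled, this, blockDiagonal_one, submatrix_one_equiv]

theorem controlled_const_queryMatrix [DecidableEq W] (O : OracleMap N T) :
    controlled (fun _ : K => queryMatrix (W := W) O) = queryMatrix O := by
  ext b b'
  simp only [controlled, submatrix_apply, blockDiagonal_apply, splitEquiv, Equiv.coe_fn_mk,
    queryMatrix, queryLabel, of_apply, Prod.ext_iff]
  split_ifs <;> simp_all

variable [Fintype K] [Fintype W]

theorem controlled_mul (M M' : K → Matrix (BasisLabel N T W) (BasisLabel N T W) ℂ) :
    controlled M * controlled M' = controlled fun k => M k * M' k := by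
  rw [controlled, controlled, submatrix_mul_equiv, ← blockDiagonal_mul, controlled]

/-- The state `v` next to the control state `c`. -/
def withControl (v : BasisLabel N T W → ℂ) (c : K → ℂ) : BasisLabel N T (W × K) → ℂ :=
  fun b => v (splitEquiv b).1 * c (splitEquiv b).2

theorem star_withControl_dotProduct (v w : BasisLabel N T W → ℂ) (c : K → ℂ)
    (M : K → Matrix (BasisLabel N T W) (BasisLabel N T W) ℂ) :
    star (withControl v c) ⬝ᵥ (controlled M *ᵥ withControl w c)
      = ∑ k, (star (c k) * c k) * (star v ⬝ᵥ (M k *ᵥ w)) := by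
  have h : controlled M *ᵥ withControl w c
      = fun b => c (splitEquiv b).2 * (M (splitEquiv b).2 *ᵥ w) (splitEquiv b).1 := by
    ext b
    simp only [mulVec, dotProduct, withControl]
    rw [← Equiv.sum_comp splitEquiv.symm]
    rw [Fintype.sum_prod_type_right]
    simp only [controlled, submatrix_apply, Equiv.apply_symm_apply, blockDiagonal_apply,
      Finset.mul_sum]
    rw [Finset.sum_eq_single (splitEquiv b).2]
    · simp only [if_true]
      exact Finset.sum_congr rfl fun i _ => by ring
    · intro k _ hk
      simp [Ne.symm hk]
    · simp
  rw [h]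
  simp only [dotProduct]
  rw [← Equiv.sum_comp splitEquiv.symm]
  rw [Fintype.sum_prod_type_right]
  simp only [Pi.star_apply, withControl, Equiv.apply_symm_apply,
    star_mul', Finset.mul_sum]
  exact Finset.sum_congr rfl fun k _ => Finset.sum_congr rfl fun i _ => by ring

variable [DecidableEq W]

theorem controlled_mem_unitaryGroup (M : K → Matrix (BasisLabel N T W) (BasisLabel N T W) ℂ)
    (hM : ∀ k, M k ∈ unitaryGroup _ ℂ) : controlled M ∈ unitaryGroup _ ℂ := by
  have h : star (controlled M) = controlled fun k => star (M k) := by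
    simp only [star_eq_conjTranspose]
    rw [controlled, conjTranspose_submatrix, blockDiagonal_conjTranspose, controlled]
  rw [mem_unitaryGroup_iff, h, controlled_mul]
  simp only [fun k => mem_unitaryGroup_iff.1 (hM k), controlled_one]

theorem Circuit.controlled_const {q : ℕ}
    {F : OracleMap N T → Matrix (BasisLabel N T W) (BasisLabel N T W) ℂ} (h : Circuit q F) :
    Circuit q fun O => controlled fun _ : K => F O := by
  induction h with
  | gate g hg => exact .gate _ (controlled_mem_unitaryGroup _ fun _ => hg)
  | query g hg q F _ ih =>
    refine (Circuit.query _ (controlled_mem_unitaryGroup (fun _ : K => g) fun _ => hg) _ _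
      ih).congr rfl fun O => ?_
    rw [← controlled_const_queryMatrix (K := K), controlled_mul, controlled_mul]

end Control

/-! ### Detecting a nonzero component by superposed Grover iterates. -/

section Detection

variable {N T : ℕ} {W : Type} [Fintype W]

/-- The projection `P` seen through the oracle-dependent unitary `A`. -/
def pulledBack (P A : Matrix (BasisLabel N T W) (BasisLabel N T W) ℂ) :
    Matrix (BasisLabel N T W) (BasisLabel N T W) ℂ := Aᴴ * (P * A)

theorem pulledBack_conjTranspose (P A : Matrix (BasisLabel N T W) (BasisLabel N T W) ℂ)
    (hP : Pᴴ = P) : (pulledBack P A)ᴴ = pulledBack P A := by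
  simp only [pulledBack, conjTranspose_mul, conjTranspose_conjTranspose, hP, Matrix.mul_assoc]

variable [DecidableEq W]

theorem pulledBack_mul_self (P A : Matrix (BasisLabel N T W) (BasisLabel N T W) ℂ)
    (hPP : P * P = P) (hA : A ∈ unitaryGroup _ ℂ) :
    pulledBack P A * pulledBack P A = pulledBack P A := by
  have h : A * Aᴴ = 1 := mem_unitaryGroup_iff.1 hA
  calc pulledBack P A * pulledBack P A = Aᴴ * (P * ((A * Aᴴ) * (P * A))) := by
        simp only [pulledBack, Matrix.mul_assoc]
    _ = pulledBack P A := by rw [h, Matrix.one_mul, ← Matrix.mul_assoc P P, hPP, pulledBack]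

variable [NeZero N]

/-- Only the reflections are controlled. Each round runs `A` and `Aᴴ` unconditionally, and they
cancel on branches where the reflections are off, so no controlled query is needed. Branch `k` is
active in its first `k` rounds. -/
theorem circuit_controlled_pow_groverStep {q : ℕ}
    {A : OracleMap N T → Matrix (BasisLabel N T W) (BasisLabel N T W) ℂ} (hA : Circuit q A)
    (v : BasisLabel N T W → ℂ) (hv : star v ⬝ᵥ v = 1)
    (P : Matrix (BasisLabel N T W) (BasisLabel N T W) ℂ) (hP : Pᴴ = P) (hPP : P * P = P)
    (M J : ℕ) :
    Circuit (2 * q * J) fun O =>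
      controlled fun k : Fin M => groverStep v (pulledBack P (A O)) ^ min (k : ℕ) J := by
  induction J with
  | zero =>
    refine (Circuit.gate 1 (one_mem _)).congr (by simp) fun O => ?_
    simp only [Nat.min_zero, pow_zero, controlled_one]
  | succ J ih =>
    have hg1 := controlled_mem_unitaryGroup
      (fun k : Fin M => if J < k then (2 : ℂ) • lineProj v - 1 else 1) fun k => by
        split_ifs
        exacts [two_smul_lineProj_sub_one_mem_unitaryGroup v hv, one_mem _]
    have hg2 := controlled_mem_unitaryGroup
      (fun k : Fin M => if J < k then 1 - (2 : ℂ) • P else 1) fun k => by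
        split_ifs
        exacts [one_sub_two_smul_mem_unitaryGroup P hP hPP, one_mem _]
    refine (((Circuit.gate _ hg1).mul (hA.conjTranspose.controlled_const (K := Fin M))).mul
      (((Circuit.gate _ hg2).mul (hA.controlled_const (K := Fin M))).mul ih)).congr
      (by ring) fun O => ?_
    simp only [controlled_mul]
    congr 1
    ext1 k
    have hu : (A O)ᴴ * A O = 1 := mem_unitaryGroup_iff'.1 (hA.mem_unitaryGroup O)
    split_ifs with h
    · rw [min_eq_right h.le, min_eq_right (Nat.succ_le_of_lt h), pow_succ', ← Matrix.mul_assoc]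
      congr 1
      have : 1 - (2 : ℂ) • pulledBack P (A O) = (A O)ᴴ * ((1 - (2 : ℂ) • P) * A O) := by
        rw [Matrix.sub_mul, Matrix.mul_sub, Matrix.one_mul, hu, Matrix.smul_mul, Matrix.mul_smul,
          pulledBack]
      rw [groverStep, this, Matrix.mul_assoc]
    · rw [min_eq_left (not_lt.1 h), min_eq_left (by omega), Matrix.one_mul, Matrix.one_mul,
        ← Matrix.mul_assoc, hu, Matrix.one_mul]

theorem Circuit.sum_norm_sq {q : ℕ}
    {F : OracleMap N T → Matrix (BasisLabel N T W) (BasisLabel N T W) ℂ} (h : Circuit q F)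
    (b₀ : BasisLabel N T W) (O : OracleMap N T) :
    ∑ b, ‖(F O *ᵥ Pi.single b₀ 1) b‖ ^ 2 = 1 := by
  rw [sum_norm_sq_mulVec _ (h.mem_unitaryGroup O), Finset.sum_eq_single b₀]
  · simp
  · intro b _ hb
    simp [hb]
  · simp

/-- Detection of a component of `A v` in the range of `P` with one-sided error. -/
theorem exists_detection_algorithm {q : ℕ}
    {A : OracleMap N T → Matrix (BasisLabel N T W) (BasisLabel N T W) ℂ} (hA : Circuit q A)
    (b₀ : BasisLabel N T W) (v : BasisLabel N T W → ℂ) (hv : star v ⬝ᵥ v = 1)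
    (P : Matrix (BasisLabel N T W) (BasisLabel N T W) ℂ) (hP : Pᴴ = P) (hPP : P * P = P)
    (M : ℕ) (hM : 0 < M) :
    ∃ alg : QueryAlgorithm N T, alg.queries = 2 * q * M ∧ ∀ O,
      (P *ᵥ (A O *ᵥ v) = 0 → alg.outputProb O true = 1) ∧
      (∀ s : ℝ, 0 < s → star (A O *ᵥ v) ⬝ᵥ (P *ᵥ (A O *ᵥ v)) = (s : ℂ) →
        1 - 1 / (M ^ 2 * s) ≤ alg.outputProb O false) := by
  have hM' : (M : ℂ) ≠ 0 := by exact_mod_cast hM.ne'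
  set c : Fin M → ℂ := fun _ => ((Real.sqrt M : ℝ) : ℂ)⁻¹ with hc
  have hcc : ∀ k, star (c k) * c k = (M : ℂ)⁻¹ := fun k => by
    simp only [hc, star_inv₀, Complex.star_def, Complex.conj_ofReal]
    rw [← mul_inv, ← Complex.ofReal_mul, Real.mul_self_sqrt (Nat.cast_nonneg M)]
    rw [Complex.ofReal_natCast]
  have hvc : star (withControl v c) ⬝ᵥ withControl v c = 1 := by
    have h := star_withControl_dotProduct v v c fun _ => 1
    rw [controlled_one, one_mulVec] at h
    rw [h]
    simp only [hcc, one_mulVec, hv, mul_one, Finset.sum_const, Finset.card_univ, Fintype.card_fin,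
      nsmul_eq_mul]
    exact mul_inv_cancel₀ hM'
  set b₁ : BasisLabel N T (W × Fin M) := splitEquiv.symm (b₀, ⟨0, hM⟩) with hb₁
  -- `G` prepares `v` with a uniform control register, so the amplitude at `b₁` after `star G` is
  -- the overlap with that prepared state.
  obtain ⟨G, hG, hGv⟩ := exists_unitary_mulVec_single b₁ _ hvc
  have hF := ((Circuit.gate (N := N) (T := T) _ (Unitary.star_mem hG)).mul
    (circuit_controlled_pow_groverStep hA v hv P hP hPP M M)).mul (Circuit.gate _ hG)
  obtain ⟨gate, hgate⟩ := hF.exists_algorithm b₁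
  set alg : QueryAlgorithm N T := ⟨W × Fin M, _, b₁, gate, fun b => decide (b = b₁)⟩ with halg
  have hstate : ∀ O, alg.state O alg.queries = _ := fun O => hgate _ O
  have htot : ∀ O, ∑ b, ‖alg.state O alg.queries b‖ ^ 2 = 1 := fun O => by
    rw [hstate]
    exact hF.sum_norm_sq b₁ O
  have htrue : ∀ O, alg.outputProb O true = ‖alg.state O alg.queries b₁‖ ^ 2 := fun O => by
    rw [QueryAlgorithm.outputProb]
    have : (Finset.univ.filter fun b => alg.outcome b = true) = {b₁} := by
      ext b
      rw [Finset.mem_filter, Finset.mem_singleton, and_iff_right (Finset.mem_univ b)]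
      exact decide_eq_true_iff
    rw [this, Finset.sum_singleton]
  have hfalse : ∀ O, alg.outputProb O false = 1 - alg.outputProb O true := fun O => by
    rw [← htot O, QueryAlgorithm.outputProb, QueryAlgorithm.outputProb,
      ← Finset.sum_filter_add_sum_filter_not Finset.univ fun b => alg.outcome b = true]
    simp
  have hamp : ∀ O, alg.state O alg.queries b₁ = (M : ℂ)⁻¹ * ∑ k ∈ Finset.range M,
      star v ⬝ᵥ (groverStep v (pulledBack P (A O)) ^ k *ᵥ v) := fun O => by
    rw [hstate, ← mulVec_mulVec, hGv, ← mulVec_mulVec]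
    have h1 : ∀ u : BasisLabel N T (W × Fin M) → ℂ,
        (star G *ᵥ u) b₁ = star (withControl v c) ⬝ᵥ u := fun u => by
      rw [← hGv, star_mulVec, ← dotProduct_mulVec, star_eq_conjTranspose, ← Pi.single_star,
        star_one, single_one_dotProduct]
    rw [h1, star_withControl_dotProduct, Finset.mul_sum, Finset.sum_range]
    refine Finset.sum_congr rfl fun k _ => ?_
    rw [hcc k, min_eq_left k.2.le]
  refine ⟨alg, by simp [halg], fun O => ⟨fun h => ?_, fun s hs h => ?_⟩⟩
  · have hQ : groverStep v (pulledBack P (A O)) *ᵥ v = v :=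
      groverStep_mulVec_of_mulVec_eq_zero v hv _ (by
        rw [pulledBack, ← mulVec_mulVec, ← mulVec_mulVec, h, mulVec_zero])
    have hQk : ∀ k : ℕ, groverStep v (pulledBack P (A O)) ^ k *ᵥ v = v := fun k => by
      induction k with
      | zero => rw [pow_zero, one_mulVec]
      | succ k ih => rw [pow_succ, ← mulVec_mulVec, hQ, ih]
    rw [htrue, hamp]
    simp only [hQk, hv, Finset.sum_const, Finset.card_range, nsmul_eq_mul, mul_one,
      inv_mul_cancel₀ hM', norm_one, one_pow]
  · have hb := norm_sum_groverStep_sq_le v hv (pulledBack P (A O))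
      (pulledBack_conjTranspose _ _ hP) (pulledBack_mul_self _ _ hPP (hA.mem_unitaryGroup O)) s hs
      (by rw [← h, pulledBack, ← mulVec_mulVec, ← mulVec_mulVec, star_mulVec,
        ← dotProduct_mulVec]) M
    rw [hfalse, htrue, hamp, norm_mul, mul_pow, norm_inv, Complex.norm_natCast, inv_pow,
      one_div, mul_inv, ← one_div s]
    gcongr

end Detection

section Superposition

variable {L ι : Type*} [Fintype L] [DecidableEq L] [Fintype ι]

theorem star_sum_single_dotProduct (e : ι → L) (he : Function.Injective e) (f : ι → ℂ) :
    star (∑ p, f p • (Pi.single (e p) 1 : L → ℂ)) ⬝ᵥ (∑ p, f p • (Pi.single (e p) 1 : L → ℂ))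
      = ∑ p, star (f p) * f p := by
  rw [dotProduct_sum]
  refine Finset.sum_congr rfl fun p _ => ?_
  rw [dotProduct_smul, dotProduct_single_one, Pi.star_apply, Finset.sum_apply,
    Finset.sum_eq_single p]
  · simp [mul_comm]
  · intro q _ hq
    simp [he.ne hq.symm]
  · simp

end Superposition

/-! ### The coherent comparison of a sample with a uniform element. -/

section PairComparison

variable {N T : ℕ}

/-- The query set `[N]`. -/
def univQuery (N : ℕ) : QuerySet N := ⟨Finset.univ, Or.inr (by simp)⟩

/-- The query set `{x, y}`, with `[N]` as a placeholder when `x = y`. -/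
def pairQuery (x y : Fin N) : QuerySet N :=
  if h : x = y then univQuery N else ⟨{x, y}, Or.inl (Finset.card_pair h)⟩

/-- The private memory: a sampled element, the sample index behind it, and a second element. -/
abbrev Memory (N T : ℕ) : Type := Fin N × Fin T × Fin N

/-- Move the sample and its index to the memory and prepare the query set of the comparison. -/
def storeEquiv : BasisLabel N T (Memory N T) ≃ BasisLabel N T (Memory N T) where
  -- The swap extends `[N] ↦ {x, y}` to a bijection on query sets. The fresh index and the zero kept
  -- in memory become the registers of the second query.
  toFun b := (Equiv.swap (univQuery N) (pairQuery b.2.2.1 b.2.2.2.2.2) b.1,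
    b.2.2.2.2.1, b.2.2.2.1, (b.2.2.1, b.2.1, b.2.2.2.2.2))
  invFun b := (Equiv.swap (univQuery N) (pairQuery b.2.2.2.1 b.2.2.2.2.2) b.1,
    b.2.2.2.2.1, b.2.2.2.1, (b.2.2.1, b.2.1, b.2.2.2.2.2))
  left_inv b := by simp
  right_inv b := by simp

/-- `contrast x y` is the vector `|x⟩ - |y⟩`. -/
def contrast (x y β : Fin N) : ℝ := (if β = x then 1 else 0) - (if β = y then 1 else 0)

theorem contrast_self (x β : Fin N) : contrast x x β = 0 := sub_self _

theorem sum_contrast_sq (x y : Fin N) (h : x ≠ y) : ∑ β, contrast x y β ^ 2 = 2 := by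
  have h1 : ∀ β, contrast x y β ^ 2 = (if β = x then 1 else 0) + (if β = y then 1 else 0) := by
    intro β
    unfold contrast
    split_ifs with h1 h2
    · exact absurd (h1.symm.trans h2) h
    all_goals norm_num
  simp only [h1, Finset.sum_add_distrib, Finset.sum_ite_eq', Finset.mem_univ, if_true]
  norm_num

/-- The isometry (on `x ≠ y`) with range the states in which the sample register is uniform and the
output register is `(|x⟩ - |y⟩) / √2`, where `x` and `y` are read from the memory. -/
noncomputable def contrastMatrix (N T : ℕ) :
    Matrix (BasisLabel N T (Memory N T)) (QuerySet N × Memory N T) ℂ :=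
  Matrix.of fun b a => if (b.1, b.2.2.2) = a then
    (((√(2 * T))⁻¹ * contrast a.2.1 a.2.2.2 b.2.2.1 : ℝ) : ℂ) else 0

/-- Distinct columns have disjoint supports. A column has squared length `T * 2 / (2 * T) = 1`, or
is zero when `x = y`. -/
theorem contrastMatrix_gram [NeZero T] : (contrastMatrix N T)ᴴ * contrastMatrix N T
    = diagonal fun a : QuerySet N × Memory N T => if a.2.1 = a.2.2.2 then 0 else 1 := by
  ext ⟨S, w⟩ ⟨S', w'⟩
  have hentry : ∀ b : BasisLabel N T (Memory N T), star (contrastMatrix N T b (S, w)) *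
      contrastMatrix N T b (S', w') = if b.1 = S then if b.2.2.2 = w then if (S, w) = (S', w') then
        (((2 * T : ℝ)⁻¹ * contrast w.1 w.2.2 b.2.2.1 ^ 2 : ℝ) : ℂ) else 0 else 0 else 0 := by
    intro b
    simp only [contrastMatrix, of_apply]
    by_cases h1 : b.1 = S
    · by_cases h2 : b.2.2.2 = w
      · rw [if_pos (by rw [h1, h2]), if_pos h1, if_pos h2, h1, h2]
        by_cases h3 : (S, w) = (S', w')
        · rw [if_pos h3, if_pos h3, ← (Prod.mk.inj h3).2, Complex.star_def,
            Complex.conj_ofReal, ← Complex.ofReal_mul]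
          congr 1
          rw [mul_mul_mul_comm, ← mul_inv, Real.mul_self_sqrt (by positivity), sq]
        · rw [if_neg h3, if_neg h3, mul_zero]
      · rw [if_neg fun h => h2 (Prod.ext_iff.1 h).2, if_pos h1, if_neg h2, star_zero, zero_mul]
    · rw [if_neg fun h => h1 (Prod.ext_iff.1 h).1, if_neg h1, star_zero, zero_mul]
  rw [Matrix.mul_apply]
  simp only [conjTranspose_apply, hentry, Fintype.sum_prod_type (α₁ := QuerySet N),
    Fintype.sum_prod_type (α₁ := Fin T), Fintype.sum_prod_type (α₂ := Memory N T)]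
  simp only [Finset.sum_ite_irrel, Finset.sum_const_zero, Finset.sum_ite_eq', Finset.mem_univ,
    if_true, diagonal_apply]
  split_ifs with h1 h2
  · rw [h2]
    simp [contrast_self]
  · rw [Finset.sum_const, Finset.card_univ, Fintype.card_fin, ← Complex.ofReal_sum,
      ← Finset.mul_sum, sum_contrast_sq _ _ h2, nsmul_eq_mul]
    push_cast
    have hT : (T : ℂ) ≠ 0 := Nat.cast_ne_zero.2 (NeZero.ne T)
    field_simp
  · rfl

/-- The projection onto the range of `contrastMatrix`. -/
noncomputable def contrastProj (N T : ℕ) :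
    Matrix (BasisLabel N T (Memory N T)) (BasisLabel N T (Memory N T)) ℂ :=
  contrastMatrix N T * (contrastMatrix N T)ᴴ

theorem contrastProj_conjTranspose : (contrastProj N T)ᴴ = contrastProj N T := by
  rw [contrastProj, conjTranspose_mul, conjTranspose_conjTranspose]

theorem contrastProj_mul_self [NeZero T] :
    contrastProj N T * contrastProj N T = contrastProj N T := by
  have h : contrastMatrix N T * ((contrastMatrix N T)ᴴ * contrastMatrix N T)
      = contrastMatrix N T := by
    rw [contrastMatrix_gram]
    ext b a
    rw [mul_diagonal]
    split_ifs with h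
    · simp [contrastMatrix, h, contrast_self]
    · rw [mul_one]
  rw [contrastProj, Matrix.mul_assoc, ← Matrix.mul_assoc _ (contrastMatrix N T),
    ← Matrix.mul_assoc, h]

theorem contrastMatrix_conjTranspose_mulVec_single (b : BasisLabel N T (Memory N T)) :
    (contrastMatrix N T)ᴴ *ᵥ Pi.single b 1
      = (((√(2 * T))⁻¹ * contrast b.2.2.2.1 b.2.2.2.2.2 b.2.2.1 : ℝ) : ℂ) •
        Pi.single (b.1, b.2.2.2) 1 := by
  rw [mulVec_single_one]
  ext a
  rw [col_apply, conjTranspose_apply, Pi.smul_apply, Pi.single_apply]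
  simp only [contrastMatrix, of_apply]
  by_cases h : (b.1, b.2.2.2) = a
  · rw [if_pos h, if_pos h.symm, ← h, Complex.star_def, Complex.conj_ofReal, smul_eq_mul, mul_one]
  · rw [if_neg h, if_neg (Ne.symm h), star_zero, smul_zero]

theorem permMat_mulVec_single {L : Type*} [Fintype L] [DecidableEq L] (σ : L ≃ L) (l : L) :
    permMat σ *ᵥ Pi.single l 1 = Pi.single (σ l) 1 := by
  rw [mulVec_single_one]
  ext i
  simp [permMat, Pi.single_apply]

variable [NeZero N]

/-- Sample `x`, then query the pair `{x, y}`. -/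
def compareEquiv (O : OracleMap N T) : BasisLabel N T (Memory N T) ≃ BasisLabel N T (Memory N T) :=
  (queryEquiv O).trans (storeEquiv.trans (queryEquiv O))

theorem circuit_compareEquiv : Circuit 2 fun O : OracleMap N T => permMat (compareEquiv O) :=
  (circuit_queryMatrix.mul ((Circuit.gate _ (permMat_mem_unitaryGroup storeEquiv)).mul
    circuit_queryMatrix)).congr rfl fun O => by
      rw [queryMatrix_eq_permMat, permMat_mul, permMat_mul, compareEquiv]
      rfl

/-- The initial label with sample indices `t`, `t'` and second element `y`. -/
def startLabel (p : (Fin T × Fin N) × Fin T) : BasisLabel N T (Memory N T) :=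
  (univQuery N, p.1.1, 0, (0, p.2, p.1.2))

theorem startLabel_injective : Function.Injective (startLabel (N := N) (T := T)) := by
  rintro ⟨⟨t, y⟩, t'⟩ ⟨⟨s, z⟩, s'⟩ h
  simp only [startLabel, Prod.mk.injEq] at h
  simp [h]

/-- The uniform superposition of the initial labels. -/
noncomputable def startState (N T : ℕ) [NeZero N] : BasisLabel N T (Memory N T) → ℂ :=
  ∑ p, (((√(T * N * T))⁻¹ : ℝ) : ℂ) • Pi.single (startLabel p) 1

theorem star_startState_dotProduct [NeZero T] :
    star (startState N T) ⬝ᵥ startState N T = 1 := by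
  have hT : (T : ℝ) ≠ 0 := Nat.cast_ne_zero.2 (NeZero.ne T)
  have hN : (N : ℝ) ≠ 0 := Nat.cast_ne_zero.2 (NeZero.ne N)
  rw [startState, star_sum_single_dotProduct _ startLabel_injective, Finset.sum_const,
    Complex.star_def, Complex.conj_ofReal, ← Complex.ofReal_mul, ← mul_inv,
    Real.mul_self_sqrt (by positivity)]
  simp only [Finset.card_univ, Fintype.card_prod, Fintype.card_fin, nsmul_eq_mul]
  have h : ((T * N * T : ℕ) : ℝ) * (T * N * T : ℝ)⁻¹ = 1 := by
    push_cast
    field_simp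
  exact_mod_cast congrArg (fun r : ℝ => (r : ℂ)) h

theorem compareEquiv_startLabel (O : OracleMap N T) (p : (Fin T × Fin N) × Fin T) :
    compareEquiv O (startLabel p) =
      (pairQuery (O (univQuery N) p.1.1) p.1.2, p.2,
        O (pairQuery (O (univQuery N) p.1.1) p.1.2) p.2,
        (O (univQuery N) p.1.1, p.1.1, p.1.2)) := by
  simp [compareEquiv, startLabel, queryEquiv, queryLabel, storeEquiv]

/-- The bias `|{t' : O({x, y}, t') = x}| - |{t' : O({x, y}, t') = y}|` for the sample `x` with
index `p.1` and `y = p.2`. -/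
def bias (O : OracleMap N T) (p : Fin T × Fin N) : ℝ :=
  ∑ t', contrast (O (univQuery N) p.1) p.2 (O (pairQuery (O (univQuery N) p.1) p.2) t')

/-- The adjoint forgets `t'`, so its branches interfere and their signs add up to `bias` inside the
amplitude. -/
theorem contrastMatrix_conjTranspose_mulVec_compare (O : OracleMap N T) :
    (contrastMatrix N T)ᴴ *ᵥ (permMat (compareEquiv O) *ᵥ startState N T)
      = ∑ p, (((√(T * N * T))⁻¹ * ((√(2 * T))⁻¹ * bias O p) : ℝ) : ℂ) •
        Pi.single (pairQuery (O (univQuery N) p.1) p.2, (O (univQuery N) p.1, p.1, p.2)) 1 := by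
  simp only [startState, mulVec_sum, mulVec_smul, permMat_mulVec_single,
    contrastMatrix_conjTranspose_mulVec_single, compareEquiv_startLabel]
  rw [Fintype.sum_prod_type]
  refine Finset.sum_congr rfl fun p _ => ?_
  simp only [smul_smul]
  rw [← Finset.sum_smul]
  congr 1
  rw [bias, Finset.mul_sum, Finset.mul_sum]
  push_cast
  rfl

theorem star_compare_dotProduct (O : OracleMap N T) :
    star (permMat (compareEquiv O) *ᵥ startState N T) ⬝ᵥ
        (contrastProj N T *ᵥ (permMat (compareEquiv O) *ᵥ startState N T))
      = (((T * N * T : ℝ)⁻¹ * (2 * T : ℝ)⁻¹ * ∑ p, bias O p ^ 2 : ℝ) : ℂ) := by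
  set u := permMat (compareEquiv O) *ᵥ startState N T with hu
  have h : star u ⬝ᵥ (contrastProj N T *ᵥ u)
      = star ((contrastMatrix N T)ᴴ *ᵥ u) ⬝ᵥ ((contrastMatrix N T)ᴴ *ᵥ u) := by
    rw [contrastProj, ← mulVec_mulVec, dotProduct_mulVec, star_mulVec _ u,
      conjTranspose_conjTranspose]
  rw [h, hu, contrastMatrix_conjTranspose_mulVec_compare, star_sum_single_dotProduct]
  · rw [Finset.mul_sum, Complex.ofReal_sum]
    refine Finset.sum_congr rfl fun p _ => ?_
    rw [Complex.star_def, Complex.conj_ofReal, ← Complex.ofReal_mul]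
    congr 1
    rw [mul_mul_mul_comm, mul_mul_mul_comm _ (bias O p), ← mul_inv, ← mul_inv,
      Real.mul_self_sqrt (by positivity), Real.mul_self_sqrt (by positivity), sq, mul_assoc,
      mul_assoc]
  -- The memory keeps `t` and `y`, so distinct choices stay orthogonal and their biases cannot
  -- cancel.
  · rintro ⟨t, y⟩ ⟨t', y'⟩ h
    simp only [Prod.mk.injEq] at h
    simp [h]

/-- One-sided test whether all pairs are unbiased. -/
theorem exists_bias_tester [NeZero T] (M : ℕ) (hM : 0 < M) :
    ∃ alg : QueryAlgorithm N T, alg.queries = 4 * M ∧ ∀ O,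
      ((∀ p, bias O p = 0) → alg.outputProb O true = 1) ∧
      (∀ s : ℝ, 0 < s → s ≤ (T * N * T : ℝ)⁻¹ * (2 * T : ℝ)⁻¹ * ∑ p, bias O p ^ 2 →
        1 - 1 / (M ^ 2 * s) ≤ alg.outputProb O false) := by
  obtain ⟨alg, hq, halg⟩ := exists_detection_algorithm (circuit_compareEquiv (N := N) (T := T))
    (startLabel ((0, 0), 0)) _ star_startState_dotProduct _ contrastProj_conjTranspose
    contrastProj_mul_self M hM
  refine ⟨alg, hq, fun O => ⟨fun h => (halg O).1 ?_, fun s hs h => ?_⟩⟩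
  · rw [contrastProj, ← mulVec_mulVec, contrastMatrix_conjTranspose_mulVec_compare]
    simp [h]
  · refine le_trans ?_ ((halg O).2 _ (hs.trans_le h) (star_compare_dotProduct O))
    have : (0 : ℝ) < M := Nat.cast_pos.2 hM
    gcongr

end PairComparison

/-! ### From distance to uniform to mean squared bias. -/

/-- A distribution that is `ε`-far from uniform has many biased pairs. -/
theorem sq_le_sum_mul_bias_sq {N : ℕ} [NeZero N] (D : Fin N → ℝ) (hD : ∀ i, 0 ≤ D i)
    (hsum : ∑ i, D i = 1) (ε : ℝ) (hε : 0 ≤ ε) (hfar : ε ≤ ∑ i, |D i - 1 / N|) :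
    N * ε ^ 2 / 4 ≤ ∑ x, ∑ y, D x * ((D x - D y) / (D x + D y)) ^ 2 := by
  have hN : (0 : ℝ) < N := Nat.cast_pos.2 (NeZero.pos N)
  -- For each `x`, `N * |D x - 1 / N| = |∑ y, (D x - D y)|`.
  have h1 : N * ε ≤ ∑ x, ∑ y, |D x - D y| := by
    refine (mul_le_mul_of_nonneg_left hfar hN.le).trans ?_
    rw [Finset.mul_sum]
    refine Finset.sum_le_sum fun x _ => ?_
    refine le_trans (le_of_eq ?_) (Finset.abs_sum_le_sum_abs _ _)
    rw [Finset.sum_sub_distrib, hsum, Finset.sum_const, Finset.card_univ, Fintype.card_fin,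
      nsmul_eq_mul, ← abs_of_pos hN, ← abs_mul, abs_of_pos hN]
    congr 1
    field_simp
  -- The Cauchy–Schwarz factorisation with weight `D x + D y`; if both masses vanish, the quotient
  -- is `0 / 0 = 0`.
  have h2 : ∀ x y, |D x - D y| ^ 2
      ≤ ((D x + D y) * ((D x - D y) / (D x + D y)) ^ 2) * (D x + D y) := by
    intro x y
    rcases (add_nonneg (hD x) (hD y)).eq_or_lt with h | h
    · have hx : D x = 0 := by linarith [hD x, hD y]
      have hy : D y = 0 := by linarith [hD x, hD y]
      simp [hx, hy]
    · rw [sq_abs]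
      apply le_of_eq
      field_simp
  have h3 := Finset.sum_sq_le_sum_mul_sum_of_sq_le_mul (Finset.univ : Finset (Fin N × Fin N))
    (r := fun p => |D p.1 - D p.2|)
    (f := fun p => (D p.1 + D p.2) * ((D p.1 - D p.2) / (D p.1 + D p.2)) ^ 2)
    (g := fun p => D p.1 + D p.2)
    (fun p _ => mul_nonneg (add_nonneg (hD _) (hD _)) (sq_nonneg _))
    (fun p _ => add_nonneg (hD _) (hD _)) (fun p _ => h2 p.1 p.2)
  simp only [Fintype.sum_prod_type] at h3
  have h4 : ∑ x, ∑ y, (D x + D y) = 2 * N := by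
    simp only [Finset.sum_add_distrib, Finset.sum_const, Finset.card_univ, Fintype.card_fin, hsum,
      nsmul_eq_mul, ← Finset.mul_sum]
    ring
  -- The squared bias is symmetric in `x` and `y`, so the two halves of the weight contribute
  -- equally.
  have h5 : ∑ x, ∑ y, (D x + D y) * ((D x - D y) / (D x + D y)) ^ 2
      = 2 * ∑ x, ∑ y, D x * ((D x - D y) / (D x + D y)) ^ 2 := by
    simp only [add_mul, Finset.sum_add_distrib]
    rw [two_mul]
    congr 1
    rw [Finset.sum_comm]
    refine Finset.sum_congr rfl fun x _ => Finset.sum_congr rfl fun y _ => ?_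
    rw [div_pow, div_pow, add_comm (D y), sub_sq_comm]
  rw [h4, h5] at h3
  have h6 : (N * ε) ^ 2 ≤ (∑ x, ∑ y, |D x - D y|) ^ 2 :=
    pow_le_pow_left₀ (by positivity) h1 2
  have h7 := h6.trans h3
  have h8 : N * (N * ε ^ 2 / 4) ≤ N * ∑ x, ∑ y, D x * ((D x - D y) / (D x + D y)) ^ 2 := by
    nlinarith
  exact le_of_mul_le_mul_left h8 hN

/-! ### The output distribution of `f`. -/

section OutputDistribution

variable {n m : ℕ} (f : (Fin n → Fin 2) → (Fin m → Fin 2))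

theorem outputDist_nonneg (i : Fin (2 ^ m)) : 0 ≤ outputDist f i := by
  unfold outputDist outputFreq
  positivity

theorem sum_outputDist_comp (g : ℝ → ℝ) : ∑ i, g (outputDist f i) = ∑ y, g (outputFreq f y) :=
  Equiv.sum_comp finFunctionFinEquiv.symm fun y => g (outputFreq f y)

theorem sum_outputFreq : ∑ y, outputFreq f y = 1 := by
  unfold outputFreq
  rw [← Finset.sum_div, ← Nat.cast_sum,
    ← Finset.card_eq_sum_card_fiberwise fun x _ => Finset.mem_coe.2 (Finset.mem_univ (f x))]
  simp

end OutputDistribution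

/-! ### The uniformity tester and the final constants. -/

section Testing

variable {N T : ℕ}

theorem Represents.eq_card_div {O : OracleMap N T} {D : Fin N → ℝ} (hO : Represents O D)
    (hsum : ∑ i, D i = 1) (i : Fin N) :
    D i = ((Finset.univ.filter fun t : Fin T => O (univQuery N) t = i).card : ℝ) / T := by
  have hw : weight D (univQuery N).1 = 1 := hsum
  rw [← hO (univQuery N) (by rw [hw]; exact one_pos) i, condDist, hw, div_one]
  exact (if_pos (Finset.mem_univ i)).symm

/-- Ensures that `{x, y}` has positive weight for every sampled `x`; on weight-zero sets
`Represents` gives no information. -/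
theorem Represents.pos_of_sample [NeZero T] {O : OracleMap N T} {D : Fin N → ℝ}
    (hO : Represents O D) (hsum : ∑ i, D i = 1) (t : Fin T) : 0 < D (O (univQuery N) t) := by
  rw [hO.eq_card_div hsum]
  refine div_pos (Nat.cast_pos.2 (Finset.card_pos.2 ⟨t, ?_⟩)) (Nat.cast_pos.2 (NeZero.pos T))
  simp

theorem Represents.bias_eq [NeZero T] {O : OracleMap N T} {D : Fin N → ℝ} (hO : Represents O D)
    (hD : ∀ i, 0 ≤ D i) (hsum : ∑ i, D i = 1) (t : Fin T) (y : Fin N) :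
    bias O (t, y) = T * ((D (O (univQuery N) t) - D y) / (D (O (univQuery N) t) + D y)) := by
  have hx := hO.pos_of_sample hsum t
  set x := O (univQuery N) t with hxt
  have hT : (T : ℝ) ≠ 0 := Nat.cast_ne_zero.2 (NeZero.ne T)
  have hb : bias O (t, y) = ∑ t', contrast x y (O (pairQuery x y) t') := rfl
  rw [hb]
  by_cases h : x = y
  · simp [h, contrast_self]
  · have hS : (pairQuery x y).1 = {x, y} := by rw [pairQuery, dif_neg h]
    have hw : weight D (pairQuery x y).1 = D x + D y := by
      rw [hS, weight, Finset.sum_pair h]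
    have hpos : 0 < D x + D y := add_pos_of_pos_of_nonneg hx (hD y)
    have h1 := hO (pairQuery x y) (by rwa [hw]) x
    have h2 := hO (pairQuery x y) (by rwa [hw]) y
    rw [condDist, hw, hS, if_pos (by simp)] at h1 h2
    simp only [contrast, Finset.sum_sub_distrib, Finset.sum_boole]
    rw [sub_div, h1, h2]
    field_simp

theorem Represents.sum_sample [NeZero T] {O : OracleMap N T} {D : Fin N → ℝ}
    (hO : Represents O D) (hsum : ∑ i, D i = 1) (g : Fin N → ℝ) :
    ∑ t, g (O (univQuery N) t) = T * ∑ x, D x * g x := by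
  have hT : (T : ℝ) ≠ 0 := Nat.cast_ne_zero.2 (NeZero.ne T)
  rw [← Finset.sum_fiberwise Finset.univ (O (univQuery N)), Finset.mul_sum]
  refine Finset.sum_congr rfl fun x _ => ?_
  rw [Finset.sum_congr rfl (g := fun _ => g x) fun t ht => by rw [(Finset.mem_filter.1 ht).2],
    Finset.sum_const, nsmul_eq_mul, hO.eq_card_div hsum x]
  field_simp

/-- Testing uniformity of a distribution with `4 * M` queries and one-sided error. -/
theorem exists_uniformity_tester [NeZero N] [NeZero T] (ε : ℝ) (hε : 0 < ε) (M : ℕ)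
    (hM : 0 < M) :
    ∃ alg : QueryAlgorithm N T, alg.queries = 4 * M ∧ ∀ (O : OracleMap N T) (D : Fin N → ℝ),
      (∀ i, 0 ≤ D i) → ∑ i, D i = 1 → Represents O D →
      ((∀ i, D i = 1 / N) → alg.outputProb O true = 1) ∧
      (ε ≤ ∑ i, |D i - 1 / N| → 1 - 8 / (M * ε) ^ 2 ≤ alg.outputProb O false) := by
  obtain ⟨alg, hq, halg⟩ := exists_bias_tester (N := N) (T := T) M hM
  refine ⟨alg, hq, fun O D hD hsum hO => ⟨fun hu => (halg O).1 ?_, fun hfar => ?_⟩⟩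
  · rintro ⟨t, y⟩
    rw [hO.bias_eq hD hsum, hu, hu, sub_self, zero_div, mul_zero]
  · have hT : (0 : ℝ) < T := Nat.cast_pos.2 (NeZero.pos T)
    have hN : (0 : ℝ) < N := Nat.cast_pos.2 (NeZero.pos N)
    -- One factor `T` counts sample indices, the other two come from squaring the unnormalised bias.
    have h1 : ∑ p, bias O p ^ 2
        = T ^ 3 * ∑ x, ∑ y, D x * ((D x - D y) / (D x + D y)) ^ 2 := by
      rw [Fintype.sum_prod_type]
      simp only [hO.bias_eq hD hsum]
      rw [hO.sum_sample hsum fun x => ∑ y, (T * ((D x - D y) / (D x + D y))) ^ 2]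
      simp only [mul_pow, ← Finset.mul_sum]
      rw [Finset.mul_sum, Finset.mul_sum]
      exact Finset.sum_congr rfl fun x _ => by ring
    have h2 : ε ^ 2 / 8 ≤ (T * N * T : ℝ)⁻¹ * (2 * T : ℝ)⁻¹ * ∑ p, bias O p ^ 2 := by
      have h3 := sq_le_sum_mul_bias_sq D hD hsum ε hε.le hfar
      rw [h1]
      calc ε ^ 2 / 8 = (T * N * T : ℝ)⁻¹ * (2 * T : ℝ)⁻¹ * (T ^ 3 * (N * ε ^ 2 / 4)) := by
            field_simp
            norm_num
        _ ≤ _ := by gcongr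
    refine le_trans (le_of_eq ?_) ((halg O).2 _ (by positivity) h2)
    field_simp

/-- The algorithm that makes no query and always outputs `true`. -/
theorem exists_trivial_algorithm [NeZero N] [NeZero T] :
    ∃ alg : QueryAlgorithm N T, alg.queries = 0 ∧ ∀ O, alg.outputProb O true = 1 := by
  have hF := Circuit.gate (N := N) (T := T) (W := Unit) 1 (one_mem _)
  obtain ⟨gate, hgate⟩ := hF.exists_algorithm (univQuery N, 0, 0, ())
  refine ⟨⟨Unit, 0, (univQuery N, 0, 0, ()), gate, fun _ => true⟩, rfl, fun O => ?_⟩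
  rw [QueryAlgorithm.outputProb, hgate]
  simpa using hF.sum_norm_sq (univQuery N, 0, 0, ()) O

end Testing

end BalancedTest

open BalancedTest in
theorem mainTheorem11 :
    ∃ (C : ℝ) (k : ℕ), 0 < C ∧
      ∀ (m : ℕ) (ε : ℝ) (T : ℕ), 0 < ε → 0 < T →
        ∃ A : QueryAlgorithm (2 ^ m) T,
          (A.queries : ℝ) ≤ C * (1 / ε) * Real.log (2 + 1 / ε) ^ k ∧
          ∀ (n : ℕ), m ≤ n → ∀ (f : (Fin n → Fin 2) → (Fin m → Fin 2))
            (O : OracleMap (2 ^ m) T), Represents O (outputDist f) →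
              (IsBalanced f → 2 / 3 ≤ A.outputProb O true) ∧
              (IsFarFromBalanced ε f → 2 / 3 ≤ A.outputProb O false) := by
  -- With `M = ⌈5 / ε⌉` and `ε ≤ 2`, `4 * M ≤ 4 * (5 / ε + 1) ≤ 28 / ε`.
  refine ⟨28, 0, by norm_num, fun m ε T hε hT => ?_⟩
  have : NeZero T := ⟨hT.ne'⟩
  rcases le_or_gt ε 2 with h2 | h2
  · have hM : 0 < ⌈5 / ε⌉₊ := Nat.ceil_pos.2 (by positivity)
    obtain ⟨A, hA, hAO⟩ := exists_uniformity_tester (N := 2 ^ m) (T := T) ε hε _ hM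
    refine ⟨A, ?_, fun n _ f O hO => ?_⟩
    · have h3 : (⌈5 / ε⌉₊ : ℝ) < 5 / ε + 1 := Nat.ceil_lt_add_one (by positivity)
      have h4 : 1 ≤ 2 / ε := (one_le_div hε).2 h2
      have h5 : 28 * (1 / ε) = 4 * (5 / ε + 2 / ε) := by ring
      rw [hA, pow_zero, mul_one, h5]
      push_cast
      linarith
    · have hsum : ∑ i, outputDist f i = 1 :=
        (sum_outputDist_comp f id).trans (sum_outputFreq f)
      obtain ⟨hu, hfar⟩ := hAO O _ (outputDist_nonneg f) hsum hO
      refine ⟨fun hb => ?_, fun hb => ?_⟩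
      · rw [hu fun i => by rw [outputDist, hb, Nat.cast_pow, Nat.cast_ofNat]]
        norm_num
      · refine le_trans ?_ (hfar (hb.trans_eq ?_))
        · have h5 : 5 ≤ ⌈5 / ε⌉₊ * ε := (div_le_iff₀ hε).1 (Nat.le_ceil _)
          -- The error is at most `8 / 25 < 1 / 3`.
          have h6 : 8 / (⌈5 / ε⌉₊ * ε) ^ 2 ≤ 8 / 5 ^ 2 := by gcongr
          linarith
        · rw [Nat.cast_pow, Nat.cast_ofNat]
          exact (sum_outputDist_comp f fun r => |r - 1 / 2 ^ m|).symm
  -- For `ε > 2` nothing is `ε`-far, since the `ℓ¹` distance of two distributions is at most `2`.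
  · obtain ⟨A, hA, hAO⟩ := exists_trivial_algorithm (N := 2 ^ m) (T := T)
    refine ⟨A, ?_, fun n _ f O _ => ⟨fun _ => ?_, fun hb => ?_⟩⟩
    · rw [hA, Nat.cast_zero]
      positivity
    · rw [hAO]
      norm_num
    · refine absurd (hb.trans ?_) (not_le.2 h2)
      calc ∑ y, |outputFreq f y - 1 / 2 ^ m| ≤ ∑ y, (outputFreq f y + 1 / 2 ^ m) := by
            refine Finset.sum_le_sum fun y _ => ?_
            have h3 : 0 ≤ outputFreq f y := by unfold outputFreq; positivity
            have h4 : (0 : ℝ) ≤ 1 / 2 ^ m := by positivity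
            exact abs_le.2 ⟨by linarith, by linarith⟩
        _ = 2 := by
            rw [Finset.sum_add_distrib, sum_outputFreq]
            simp
            norm_num
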